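/- Let $\Gamma$ be a finite simple graph with vertex set $V(\Gamma)$ and edge set $E(\Gamma)$, and let $$G(\Gamma)=\langle\, v\in V(\Gamma)\mid uv=vu \text{ if } \{u,v\}\notin E(\Gamma)\,\rangle$$ be the right-angled Artin group in which two distinct generators commute when they are \emph{not} adjacent. For $g\in G(\Gamma)$ let $|g|$ be the word length of $g$ with respect to $V(\Gamma)^{\pm1}$; a word representing $g$ is reduced if its length is $|g|$; and the support $\mathrm{supp}(g)$ is the set of all $v\in V(\Gamma)$ such that $v$ or $v^{-1}$ appears in a reduced word representing $g$. Elements $g,g'$ disjointly commute if $\mathrm{supp}(g)\cap\mathrm{supp}(g')=\emptyset$ and no vertex of $\mathrm{supp}(g)$ is adjacent to a vertex of $\mathrm{supp}(g')$. An element $g$ is strongly non-split if $\mathrm{supp}(g)$ spans a connected subgraph of $\Gamma$ and no generator $v\in V(\Gamma)$ disjointly commutes with $g$. An element $g\neq 1$ is primitive if there are no $u\in G(\Gamma)$ and $n\ge 2$ with $g=u^n$. A decomposition $g=g_1\cdots g_k$ is geodesic if $|g|=|g_1|+\cdots+|g_k|$; a decomposition $h=ag^nb$ is called geodesic if $h=a\cdot\underbrace{g\cdots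 g}_{n}\cdot b$ is geodesic, i.e. $|h|=|a|+n|g|+|b|$. \textbf{Proposition.} Let $\Gamma$ be a finite connected simple graph, and let $$h=a_1g_1^{n_1}b_1=a_2g_2^{n_2}b_2$$ be two geodesic decompositions of $h\in G(\Gamma)$, where $n_i\ge 1$ and $a_i,b_i,g_i\in G(\Gamma)$ for $i=1,2$. Suppose that $g_1$ and $g_2$ are strongly non-split and primitive and that there exist real constants $A,B\ge 0$ such that $$|a_i|\le A,\qquad |b_i|\le B,\qquad |h|-(A+B)\ge (2|V(\Gamma)|+1)\,|g_i|\qquad\text{for } i=1,2.$$ Then $g_1$ and $g_2$ are conjugate in $G(\Gamma)$, and moreover $$a_1g_1a_1^{-1}=a_2g_2a_2^{-1}\qquad\text{and}\qquad b_1^{-1}g_1b_1=b_2^{-1}g_2b_2.$$ -/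

import Mathlib

namespace RAAG

variable {V : Type*}

/-- The right-angled Artin group `G(Γ)`, in the convention in which two generators commute if and
only if they are *not* joined by an edge:
`G(Γ) = ⟨ v ∈ V | [u, v] = 1 if {u, v} is not an edge of Γ ⟩`. -/
abbrev Grp (Γ : SimpleGraph V) : Type _ :=
  PresentedGroup
    {r : FreeGroup V | ∃ u v : V, ¬ Γ.Adj u v ∧
      r = FreeGroup.of u * FreeGroup.of v * (FreeGroup.of u)⁻¹ * (FreeGroup.of v)⁻¹}

/-- The generator of `G(Γ)` given by a vertex. -/
def gen (Γ : SimpleGraph V) (v : V) : Grp Γ := PresentedGroup.of v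

/-- The element of `G(Γ)` represented by a word; the letter `(v, true)` stands for `v` and
`(v, false)` for `v⁻¹`. -/
def ofWord (Γ : SimpleGraph V) (w : List (V × Bool)) : Grp Γ :=
  PresentedGroup.mk _ (FreeGroup.mk w)

variable {Γ : SimpleGraph V}

/-- A word is reduced if it is a shortest word among all words representing the same element. -/
def IsReducedWord (Γ : SimpleGraph V) (w : List (V × Bool)) : Prop :=
  ∀ w' : List (V × Bool), ofWord Γ w' = ofWord Γ w → w.length ≤ w'.length

/-- The word length `|g|`: the least length of a word representing `g`. -/
noncomputable def wordLength (g : Grp Γ) : ℕ :=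
  sInf {n : ℕ | ∃ w : List (V × Bool), ofWord Γ w = g ∧ w.length = n}

/-- The support of `g`: the vertices `v` such that `v` or `v⁻¹` appears in a reduced word
representing `g`. -/
def supp (g : Grp Γ) : Set V :=
  {v | ∃ w : List (V × Bool), IsReducedWord Γ w ∧ ofWord Γ w = g ∧ ∃ ε : Bool, (v, ε) ∈ w}

/-- `g₁` and `g₂` disjointly commute: their supports are disjoint and each generator in the first
support commutes with (that is, is not adjacent to) each generator in the second. -/
def DisjointlyCommute (g₁ g₂ : Grp Γ) : Prop :=
  Disjoint (supp g₁) (supp g₂) ∧ ∀ v₁ ∈ supp g₁, ∀ v₂ ∈ supp g₂, ¬ Γ.Adj v₁ v₂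

/-- `g` is non-split if its support spans a connected subgraph of `Γ`. -/
def NonSplit (g : Grp Γ) : Prop := (Γ.induce (supp g)).Connected

/-- `g` is strongly non-split if it is non-split and no generator disjointly commutes with it. -/
def StronglyNonSplit (g : Grp Γ) : Prop :=
  NonSplit g ∧ ¬ ∃ v : V, DisjointlyCommute (gen Γ v) g

/-- `g` is primitive if it is nontrivial and not a nontrivial power of another element. -/
def IsPrimitive (g : Grp Γ) : Prop :=
  g ≠ 1 ∧ ¬ ∃ (u : Grp Γ) (n : ℕ), 2 ≤ n ∧ g = u ^ n

/-- `g = g₁ ⋯ g_k` is a geodesic decomposition, where `l = [g₁, …, g_k]`: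
`|g| = |g₁| + ⋯ + |g_k|`. -/
def IsGeodesicDecomposition (g : Grp Γ) (l : List (Grp Γ)) : Prop :=
  g = l.prod ∧ wordLength g = (l.map wordLength).sum

/-- `h = a gⁿ b` is a geodesic decomposition, `gⁿ` being read as the product of `n` factors `g`:
`h = a · g · g ⋯ g · b` and `|h| = |a| + n |g| + |b|`. -/
def IsGeodesicPowerDecomposition (h a g : Grp Γ) (n : ℕ) (b : Grp Γ) : Prop :=
  IsGeodesicDecomposition h ([a] ++ List.replicate n g ++ [b])

end RAAG

/-! A reduced word is determined by the element it represents up to commutations of letters,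
because `G(Γ)` acts on the reduced words modulo commutations. Such a commutation class is in turn
determined by its projections to the cliques of `Γ`, which are elements of free monoids.

Since `g` is strongly non-split, the connected subgraph spanned by `supp g` dominates `Γ`. Of two
prefixes of the same class, one contains the other over each edge. Following this along a path
through `supp g`, which has fewer than `|V|` edges, one sees that a prefix `c` with more letters
over some vertex than `a gᵏ` contains `a gᵏ⁻ᵈ` over all vertices, where `d` is about `|V|`. So a
bound on the length of `c` bounds all its projections. Applied from both ends of `h`, this makes
the runs `g₁ ⋯ g₁` and `g₂ ⋯ g₂` overlap in each clique by at least the sum of the lengths of the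
projections of `g₁` and `g₂`.

By the theorem of Fine and Wilf, the projections of `g₁` and `g₂` are then powers of conjugate
words. The ratio of the exponents is the same for all cliques, as `supp g₁` is connected, and it
is `1` by primitivity. Hence each projection of the run of `g₁` can be extended by one period
together with that of `g₂`: besides the two decompositions of `h`, the same equation holds with
`n₁ + 1` and `n₂ + 1`, and the quotient of the two equations is the assertion. -/

namespace RAAG

open FreeMonoid

/-! ### Words: powers, prefixes and overlapping runs

In a free monoid `u ∣ w` says that `u` is a prefix of `w`. -/

section Words

variable {α : Type*}

theorem length_pow (w : FreeMonoid α) (n : ℕ) : (w ^ n).length = n * w.length := by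
  induction n with
  | zero => simp
  | succ n ih => rw [pow_succ, length_mul, ih, Nat.succ_mul]

theorem countP'_pow (p : α → Prop) [DecidablePred p] (w : FreeMonoid α) (n : ℕ) :
    (w ^ n).countP' p = n * w.countP' p := by
  induction n with
  | zero => simp [countP'_one]
  | succ n ih => rw [pow_succ, countP'_mul, ih, Nat.succ_mul]

theorem reverse_pow (w : FreeMonoid α) (n : ℕ) : reverse (w ^ n) = reverse w ^ n := by
  induction n with
  | zero => rfl
  | succ n ih => rw [pow_succ, reverse_mul, ih, pow_succ']

theorem of_dvd_of_mul_iff {x y : α} {w : FreeMonoid α} : of x ∣ of y * w ↔ x = y := by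
  constructor
  · rintro ⟨r, h⟩
    exact (List.cons.inj h).1.symm
  · rintro rfl
    exact dvd_mul_right _ _

theorem eq_one_or_of_dvd {x : α} {u w : FreeMonoid α} (h : of x ∣ u * w) :
    u = 1 ∨ of x ∣ u := by
  cases u using FreeMonoid.casesOn with
  | one => exact Or.inl rfl
  | of_mul y u =>
    rw [mul_assoc] at h
    exact Or.inr (of_dvd_of_mul_iff.2 (of_dvd_of_mul_iff.1 h))

theorem exists_mul_of_mul_eq_mul {u v a b : FreeMonoid α} (h : u * a = v * b)
    (hl : u.length ≤ v.length) : ∃ c, v = u * c ∧ a = c * b := by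
  obtain ⟨c, hc⟩ : toList u <+: toList v :=
    List.prefix_of_prefix_length_le ⟨toList a, rfl⟩ ⟨toList b, congrArg toList h.symm⟩ hl
  obtain rfl : u * ofList c = v := hc
  exact ⟨ofList c, rfl, mul_left_cancel (h.trans (mul_assoc _ _ _))⟩

theorem dvd_of_dvd_of_length_le {u v w : FreeMonoid α} (hu : u ∣ w) (hv : v ∣ w)
    (hl : u.length ≤ v.length) : u ∣ v := by
  obtain ⟨a, rfl⟩ := hu
  obtain ⟨b, h⟩ := hv
  obtain ⟨c, hc, -⟩ := exists_mul_of_mul_eq_mul h hl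
  exact ⟨c, hc⟩

theorem eq_of_dvd_of_length_eq {u v w : FreeMonoid α} (hu : u ∣ w) (hv : v ∣ w)
    (hl : u.length = v.length) : u = v := by
  obtain ⟨c, rfl⟩ := dvd_of_dvd_of_length_le hu hv hl.le
  have hc : c = 1 := by
    rw [← length_eq_zero]
    rw [length_mul] at hl
    omega
  rw [hc, mul_one]

theorem dvd_of_dvd_pow {x t : FreeMonoid α} {n : ℕ} (ht : t ∣ x ^ n)
    (hl : x.length ≤ t.length) : x ∣ t :=
  dvd_of_dvd_of_length_le (dvd_pow_self x n.succ_ne_zero)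
    (ht.trans (pow_dvd_pow x n.le_succ)) hl

theorem exists_pow_of_commute (x y : FreeMonoid α) (h : Commute x y) :
    ∃ z k l, x = z ^ k ∧ y = z ^ l := by
  induction hn : x.length + y.length using Nat.strong_induction_on generalizing x y with
  | _ n ih =>
    subst hn
    wlog hle : x.length ≤ y.length generalizing x y
    · obtain ⟨z, k, l, hx, hy⟩ := this y x h.symm
        (fun m hm a b hab hl => ih m (by omega) a b hab hl) (by omega)
      exact ⟨z, l, k, hy, hx⟩
    rcases eq_or_ne x 1 with rfl | hx
    · exact ⟨y, 0, 1, (pow_zero y).symm, (pow_one y).symm⟩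
    have hpos : 0 < x.length := Nat.pos_of_ne_zero (mt length_eq_zero.1 hx)
    obtain ⟨y', rfl, hy'⟩ := exists_mul_of_mul_eq_mul h.eq hle
    obtain ⟨z, k, l, hx, hy⟩ := ih (x.length + y'.length)
      (by rw [length_mul]; omega) x y' hy' rfl
    exact ⟨z, k, k + l, hx, by rw [pow_add, ← hx, ← hy]⟩

/-- The theorem of Fine and Wilf, without its sharp bound on the overlap. -/
theorem commute_of_dvd_pow {x y t : FreeMonoid α} {m n : ℕ} (hx : t ∣ x ^ m) (hy : t ∣ y ^ n)
    (hl : x.length + y.length ≤ t.length) : Commute x y := by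
  have mul_dvd {x y : FreeMonoid α} {m n : ℕ} (hx : t ∣ x ^ m) (hy : t ∣ y ^ n)
      (hl : x.length + y.length ≤ t.length) : x * y ∣ t := by
    obtain ⟨t', rfl⟩ := dvd_of_dvd_pow hx (by omega)
    rw [length_mul] at hl
    have hyt : y ∣ x * t' := dvd_of_dvd_pow hy (by rw [length_mul]; omega)
    have ht' : t' ∣ x ^ m := by
      obtain ⟨r, hr⟩ := hx.trans (pow_dvd_pow x m.le_succ)
      exact ⟨r, mul_left_cancel (a := x) (by rw [← pow_succ', hr, mul_assoc])⟩
    have htt : t' ∣ x * t' := dvd_of_dvd_of_length_le ht' hx (by rw [length_mul]; omega)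
    exact mul_dvd_mul_left x (dvd_of_dvd_of_length_le hyt htt (by omega))
  refine eq_of_dvd_of_length_eq (mul_dvd hx hy hl) (mul_dvd hy hx (by omega)) ?_
  rw [length_mul, length_mul, add_comm]

theorem exists_conj_of_mul_eq_pow {c r g : FreeMonoid α} {n : ℕ} (h : c * r = g ^ n) :
    ∃ x, g * c = c * x ∧ r * g = x * r ∧ r * c = x ^ n := by
  have hshift : c * (r * g) = g * c * r := by
    rw [← mul_assoc, h, ← pow_succ, pow_succ', ← h, mul_assoc]
  obtain ⟨x, hx, hxr⟩ := exists_mul_of_mul_eq_mul hshift (by rw [length_mul]; omega)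
  have hconj : SemiconjBy c x g := hx.symm
  refine ⟨x, hx, hxr, mul_left_cancel (a := c) ?_⟩
  rw [← mul_assoc, h, (hconj.pow_right n).eq]

theorem perm_of_mul_eq_mul {w z c : FreeMonoid α} (h : w * c = c * z) :
    (toList w).Perm (toList z) := by
  rw [← List.perm_append_right_iff (toList c)]
  exact (List.Perm.of_eq h).trans List.perm_append_comm

theorem length_eq_of_mul_eq_mul {w z c : FreeMonoid α} (h : w * c = c * z) :
    w.length = z.length :=
  (perm_of_mul_eq_mul h).length_eq

/-- Two runs `g₁ ^ n₁` and `g₂ ^ n₂`, placed at `a₁` and `a₂` in the same word, that overlap in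
length at least `|g₁| + |g₂|`. Written with the complements of the runs, the length of the overlap
is the length of the whole word minus `max |a₁| |a₂|` and `max |b₁| |b₂|`. -/
structure Overlap (a₁ g₁ b₁ a₂ g₂ b₂ : FreeMonoid α) (n₁ n₂ : ℕ) : Prop where
  eq : a₁ * g₁ ^ n₁ * b₁ = a₂ * g₂ ^ n₂ * b₂
  length_le : max a₁.length a₂.length + max b₁.length b₂.length + g₁.length + g₂.length ≤
    (a₁ * g₁ ^ n₁ * b₁).length

namespace Overlap

variable {a₁ g₁ b₁ a₂ g₂ b₂ : FreeMonoid α} {n₁ n₂ : ℕ}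

theorem symm (h : Overlap a₁ g₁ b₁ a₂ g₂ b₂ n₁ n₂) : Overlap a₂ g₂ b₂ a₁ g₁ b₁ n₂ n₁ where
  eq := h.eq.symm
  length_le := by
    have := h.length_le
    rw [h.eq] at this
    omega

theorem length_add_length_le (h : Overlap a₁ g₁ b₁ a₂ g₂ b₂ n₁ n₂) :
    g₁.length + g₂.length ≤ n₁ * g₁.length := by
  have := h.length_le
  simp only [length_mul, length_pow] at this
  omega

theorem exists_common_prefix (h : Overlap a₁ g₁ b₁ a₂ g₂ b₂ n₁ n₂)
    (hle : a₁.length ≤ a₂.length) :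
    ∃ c r x t, a₂ = a₁ * c ∧ g₁ * c = c * x ∧ r * c = x ^ n₁ ∧
      t ∣ x ^ n₁ ∧ t ∣ g₂ ^ n₂ ∧ g₁.length + g₂.length ≤ t.length := by
  have hlen₁ := h.length_le
  have hlen₂ := h.symm.length_le
  have heq := h.eq
  simp only [length_mul, length_pow] at hlen₁ hlen₂
  rw [mul_assoc, mul_assoc] at heq
  obtain ⟨c, rfl, hc⟩ := exists_mul_of_mul_eq_mul heq hle
  rw [length_mul] at hlen₁ hlen₂
  obtain ⟨r, hr, hrb⟩ := exists_mul_of_mul_eq_mul hc.symm (by rw [length_pow]; omega)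
  have hlen : c.length + r.length = n₁ * g₁.length := by rw [← length_mul, ← hr, length_pow]
  obtain ⟨x, hx, -, hrx⟩ := exists_conj_of_mul_eq_pow hr.symm
  have hr_dvd : r ∣ g₂ ^ n₂ * b₂ := ⟨b₁, hrb⟩
  have hrun_dvd : g₂ ^ n₂ ∣ g₂ ^ n₂ * b₂ := dvd_mul_right _ _
  rcases le_total r.length (g₂ ^ n₂).length with hle | hle
  · exact ⟨c, r, x, r, rfl, hx, hrx, ⟨c, hrx.symm⟩,
      dvd_of_dvd_of_length_le hr_dvd hrun_dvd hle, by omega⟩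
  · exact ⟨c, r, x, g₂ ^ n₂, rfl, hx, hrx,
      (dvd_of_dvd_of_length_le hrun_dvd hr_dvd hle).trans ⟨c, hrx.symm⟩, dvd_rfl,
      by rw [length_pow]; omega⟩

theorem exists_roots (h : Overlap a₁ g₁ b₁ a₂ g₂ b₂ n₁ n₂) :
    ∃ w₁ w₂ k l, g₁ = w₁ ^ k ∧ g₂ = w₂ ^ l ∧ (toList w₁).Perm (toList w₂) := by
  wlog hle : a₁.length ≤ a₂.length generalizing a₁ g₁ b₁ a₂ g₂ b₂ n₁ n₂
  · obtain ⟨w₁, w₂, k, l, h₁, h₂, hperm⟩ := this h.symm (by omega)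
    exact ⟨w₂, w₁, l, k, h₂, h₁, hperm.symm⟩
  obtain ⟨c, r, x, t, -, hx, hrx, htx, htg, hl⟩ := h.exists_common_prefix hle
  have hlen : g₁.length = x.length := length_eq_of_mul_eq_mul hx
  obtain ⟨z, k, l, rfl, h₂⟩ := exists_pow_of_commute x g₂ (commute_of_dvd_pow htx htg (by omega))
  obtain ⟨w, -, hw, -⟩ := exists_conj_of_mul_eq_pow (hrx.trans (pow_mul z k n₁).symm)
  have hconj : SemiconjBy c z w := hw
  refine ⟨w, z, k, l, mul_right_cancel (b := c) ?_, h₂, perm_of_mul_eq_mul hw.symm⟩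
  rw [hx, (hconj.pow_right k).eq]

theorem countP'_mul_countP' (h : Overlap a₁ g₁ b₁ a₂ g₂ b₂ n₁ n₂) (p q : α → Prop)
    [DecidablePred p] [DecidablePred q] :
    g₁.countP' p * g₂.countP' q = g₂.countP' p * g₁.countP' q := by
  obtain ⟨w₁, w₂, k, l, rfl, rfl, hperm⟩ := h.exists_roots
  have hcount (p : α → Prop) [DecidablePred p] : w₁.countP' p = w₂.countP' p := hperm.countP_eq _
  simp only [countP'_pow, hcount]
  ring

theorem exists_root (h : Overlap a₁ g₁ b₁ a₂ g₂ b₂ n₁ n₂) {s t : ℕ} (hst : s.Coprime t)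
    (hl : g₁.length * t = g₂.length * s) : ∃ w, g₁ = w ^ s := by
  obtain ⟨w₁, w₂, k, l, rfl, rfl, hperm⟩ := h.exists_roots
  have hlen : w₁.length = w₂.length := hperm.length_eq
  rcases Nat.eq_zero_or_pos w₁.length with h0 | hpos
  · exact ⟨1, by rw [length_eq_zero.1 h0, one_pow, one_pow]⟩
  rw [length_pow, length_pow, ← hlen] at hl
  have hkl : k * t = l * s := Nat.eq_of_mul_eq_mul_right hpos (by linarith)
  obtain ⟨m, rfl⟩ : s ∣ k := hst.dvd_of_dvd_mul_right (hkl ▸ dvd_mul_left s l)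
  exact ⟨w₁ ^ m, by rw [← pow_mul, mul_comm]⟩

theorem pow_succ_eq (h : Overlap a₁ g₁ b₁ a₂ g₂ b₂ n₁ n₂) (hl : g₁.length = g₂.length) :
    a₁ * g₁ ^ (n₁ + 1) * b₁ = a₂ * g₂ ^ (n₂ + 1) * b₂ := by
  wlog hle : a₁.length ≤ a₂.length generalizing a₁ g₁ b₁ a₂ g₂ b₂ n₁ n₂
  · exact (this h.symm hl.symm (by omega)).symm
  obtain ⟨c, r, x, t, rfl, hx, -, htx, htg, hlt⟩ := h.exists_common_prefix hle
  have hlen : g₁.length = x.length := length_eq_of_mul_eq_mul hx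
  obtain rfl : x = g₂ := eq_of_dvd_of_length_eq (dvd_of_dvd_pow htx (by omega))
    (dvd_of_dvd_pow htg (by omega)) (by omega)
  have hrun : g₁ ^ n₁ * b₁ = c * x ^ n₂ * b₂ :=
    mul_left_cancel (a := a₁) (by simpa only [mul_assoc] using h.eq)
  calc a₁ * g₁ ^ (n₁ + 1) * b₁ = a₁ * g₁ * (g₁ ^ n₁ * b₁) := by simp only [pow_succ', mul_assoc]
    _ = a₁ * (g₁ * c) * x ^ n₂ * b₂ := by rw [hrun]; simp only [mul_assoc]
    _ = a₁ * c * x ^ (n₂ + 1) * b₂ := by rw [hx]; simp only [pow_succ', mul_assoc]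

end Overlap

end Words

/-! ### Words as elements of the group -/

section Evaluation

variable {V : Type*} {Γ : SimpleGraph V}

/-- Evaluation of words in `G(Γ)`: the map `ofWord` as a homomorphism of monoids. -/
def eval (Γ : SimpleGraph V) : FreeMonoid (V × Bool) →* Grp Γ where
  toFun w := ofWord Γ (toList w)
  map_one' := rfl
  map_mul' w w' := by simp only [ofWord, toList_mul, ← FreeGroup.mul_mk, map_mul]

theorem eval_surjective : Function.Surjective (eval Γ) := by
  intro g
  obtain ⟨f, rfl⟩ := PresentedGroup.mk_surjective _ g
  obtain ⟨w, rfl⟩ := Quot.exists_rep f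
  exact ⟨ofList w, rfl⟩

/-- The letter representing the inverse of the generator (or inverse generator) given by `x`. -/
def letterInv (x : V × Bool) : V × Bool := (x.1, !x.2)

theorem letterInv_letterInv (x : V × Bool) : letterInv (letterInv x) = x := by
  simp [letterInv]

theorem eval_of_true (v : V) : eval Γ (of (v, true)) = gen Γ v := rfl

theorem eval_of_false (v : V) : eval Γ (of (v, false)) = (gen Γ v)⁻¹ := rfl

theorem eval_of_letterInv (x : V × Bool) : eval Γ (of (letterInv x)) = (eval Γ (of x))⁻¹ := by
  obtain ⟨v, _ | _⟩ := x
  · exact (inv_inv _).symm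
  · rfl

theorem commute_gen {u v : V} (huv : ¬ Γ.Adj u v) : Commute (gen Γ u) (gen Γ v) := by
  have h : (PresentedGroup.mk _ (FreeGroup.of u * FreeGroup.of v * (FreeGroup.of u)⁻¹ *
      (FreeGroup.of v)⁻¹) : Grp Γ) = 1 :=
    PresentedGroup.one_of_mem ⟨u, v, huv, rfl⟩
  simp only [map_mul, map_inv] at h
  rw [mul_inv_eq_one, mul_inv_eq_iff_eq_mul] at h
  exact h

/-- Independence of letters: their vertices are distinct and not adjacent. Letters over the same
vertex are excluded although they commute in `G(Γ)`, since they do not commute in the trace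
monoid. -/
def Indep (Γ : SimpleGraph V) (x y : V × Bool) : Prop := x.1 ≠ y.1 ∧ ¬ Γ.Adj x.1 y.1

theorem Indep.symm {x y : V × Bool} (h : Indep Γ x y) : Indep Γ y x :=
  ⟨h.1.symm, fun hadj => h.2 hadj.symm⟩

theorem Indep.commute_eval {x y : V × Bool} (h : Indep Γ x y) :
    Commute (eval Γ (of x)) (eval Γ (of y)) := by
  have hgen := commute_gen h.2
  obtain ⟨u, _ | _⟩ := x <;> obtain ⟨v, _ | _⟩ := y <;>
    simpa [eval_of_true, eval_of_false] using hgen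

theorem exists_isReducedWord (g : Grp Γ) : ∃ w, IsReducedWord Γ (toList w) ∧ eval Γ w = g := by
  have hne : {n : ℕ | ∃ w, ofWord Γ w = g ∧ w.length = n}.Nonempty := by
    obtain ⟨w, hw⟩ := eval_surjective g
    exact ⟨_, toList w, hw, rfl⟩
  obtain ⟨w, hw, hl⟩ := Nat.sInf_mem hne
  refine ⟨ofList w, fun w' hw' => ?_, hw⟩
  rw [toList_ofList, hl]
  exact Nat.sInf_le ⟨w', hw'.trans hw, rfl⟩

theorem wordLength_eval_le (w : FreeMonoid (V × Bool)) : wordLength (eval Γ w) ≤ w.length :=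
  Nat.sInf_le ⟨toList w, rfl, rfl⟩

theorem isReducedWord_iff {w : FreeMonoid (V × Bool)} :
    IsReducedWord Γ (toList w) ↔ w.length = wordLength (eval Γ w) := by
  constructor
  · intro h
    refine le_antisymm (le_csInf ⟨_, toList w, rfl, rfl⟩ ?_) (wordLength_eval_le w)
    rintro n ⟨w', hw', rfl⟩
    exact h w' hw'
  · intro h w' hw'
    exact h.trans_le ((congrArg wordLength hw').symm.trans_le (wordLength_eval_le (ofList w')))

theorem IsReducedWord.of_mul_right {w w' : FreeMonoid (V × Bool)}
    (h : IsReducedWord Γ (toList (w * w'))) : IsReducedWord Γ (toList w') := by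
  intro w'' hw''
  have := h (toList (w * ofList w''))
    (((eval Γ).map_mul _ _).trans ((congrArg _ hw'').trans ((eval Γ).map_mul _ _).symm))
  simpa using this

theorem IsGeodesicPowerDecomposition.eq {h a g b : Grp Γ} {n : ℕ}
    (hd : IsGeodesicPowerDecomposition h a g n b) : h = a * g ^ n * b := by
  simpa [mul_assoc] using hd.1

theorem IsGeodesicPowerDecomposition.wordLength_eq {h a g b : Grp Γ} {n : ℕ}
    (hd : IsGeodesicPowerDecomposition h a g n b) :
    wordLength h = wordLength a + n * wordLength g + wordLength b := by
  simpa [add_assoc] using hd.2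

theorem IsGeodesicPowerDecomposition.isReducedWord {h : Grp Γ} {a g b : FreeMonoid (V × Bool)}
    {n : ℕ} (hd : IsGeodesicPowerDecomposition h (eval Γ a) (eval Γ g) n (eval Γ b))
    (ha : IsReducedWord Γ (toList a)) (hg : IsReducedWord Γ (toList g))
    (hb : IsReducedWord Γ (toList b)) : IsReducedWord Γ (toList (a * g ^ n * b)) := by
  have heval : eval Γ (a * g ^ n * b) = h := by rw [hd.eq, map_mul, map_mul, map_pow]
  rw [isReducedWord_iff] at *
  rw [heval, hd.wordLength_eq, length_mul, length_mul, length_pow, ha, hg, hb]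

end Evaluation

/-! ### Projections to cliques -/

section Projection

variable {V : Type*} {Γ : SimpleGraph V} [DecidableEq V]

/-- A clique of `Γ`. The letters over the vertices of a clique generate a free monoid in the trace
monoid of `Γ`, and the projections to these free monoids determine a trace. -/
abbrev Clique (Γ : SimpleGraph V) : Type _ := {K : Finset V // Γ.IsClique (K : Set V)}

/-- The clique `{v}`. -/
def Clique.single (Γ : SimpleGraph V) (v : V) : Clique Γ := ⟨{v}, by simp⟩

/-- The clique formed by the ends of an edge. -/
def Clique.edge {u v : V} (h : Γ.Adj u v) : Clique Γ := ⟨{u, v}, by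
  simpa [SimpleGraph.isClique_pair] using fun _ => h⟩

/-- The family of all projections of a word to cliques, the projection to `K` keeping the letters
over the vertices of `K`. Its image is a copy of the trace monoid of `Γ`. -/
def proj (Γ : SimpleGraph V) :
    FreeMonoid (V × Bool) →* (Clique Γ → FreeMonoid (V × Bool)) :=
  lift fun x K => if x.1 ∈ K.1 then of x else 1

theorem proj_of_apply (x : V × Bool) (K : Clique Γ) :
    proj Γ (of x) K = if x.1 ∈ K.1 then of x else 1 := by
  rw [proj, lift_eval_of]

theorem proj_of_dvd_iff {x : V × Bool} {s : Clique Γ → FreeMonoid (V × Bool)} :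
    proj Γ (of x) ∣ s ↔ ∀ K : Clique Γ, x.1 ∈ K.1 → of x ∣ s K := by
  rw [pi_dvd_iff]
  refine forall_congr' fun K => ?_
  rw [proj_of_apply]
  split_ifs with h <;> simp [h]

theorem not_proj_of_dvd_one (x : V × Bool) : ¬ proj Γ (of x) ∣ 1 := by
  rw [proj_of_dvd_iff]
  intro h
  obtain ⟨r, hr⟩ := h (Clique.single Γ x.1) (Finset.mem_singleton_self _)
  exact List.cons_ne_nil _ _ hr.symm

section

variable {x : V × Bool} {s : Clique Γ → FreeMonoid (V × Bool)}
  (hs : ∀ K : Clique Γ, x.1 ∈ K.1 → s K = 1)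

include hs

theorem commute_proj_of : Commute (proj Γ (of x)) s := by
  refine funext fun K => ?_
  rw [Pi.mul_apply, Pi.mul_apply]
  by_cases hx : x.1 ∈ K.1
  · rw [hs K hx, one_mul, mul_one]
  · rw [proj_of_apply, if_neg hx, one_mul, mul_one]

theorem proj_of_dvd_mul_iff {t : Clique Γ → FreeMonoid (V × Bool)} :
    proj Γ (of x) ∣ s * t ↔ proj Γ (of x) ∣ t := by
  rw [proj_of_dvd_iff, proj_of_dvd_iff]
  refine forall₂_congr fun K hx => ?_
  rw [Pi.mul_apply, hs K hx, one_mul]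

end

namespace Indep

variable {x y : V × Bool} (h : Indep Γ x y)

include h

theorem proj_of_apply_eq_one (K : Clique Γ) (hx : x.1 ∈ K.1) : proj Γ (of y) K = 1 := by
  have hy : y.1 ∉ K.1 := fun hy => h.2 (K.2 hx hy h.1)
  rw [proj_of_apply, if_neg hy]

theorem commute_proj : Commute (proj Γ (of x)) (proj Γ (of y)) :=
  commute_proj_of h.proj_of_apply_eq_one

theorem proj_of_dvd_mul_iff {s : Clique Γ → FreeMonoid (V × Bool)} :
    proj Γ (of x) ∣ proj Γ (of y) * s ↔ proj Γ (of x) ∣ s :=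
  RAAG.proj_of_dvd_mul_iff h.proj_of_apply_eq_one

end Indep

theorem eq_or_indep_of_dvd_mul {x y : V × Bool} {s : Clique Γ → FreeMonoid (V × Bool)}
    (h : proj Γ (of x) ∣ proj Γ (of y) * s) : x = y ∨ Indep Γ x y := by
  have eq_of_mem (K : Clique Γ) (hx : x.1 ∈ K.1) (hy : y.1 ∈ K.1) : x = y := by
    have := proj_of_dvd_iff.1 h K hx
    rwa [Pi.mul_apply, proj_of_apply, if_pos hy, of_dvd_of_mul_iff] at this
  refine or_iff_not_imp_left.2 fun hne => ⟨fun heq => ?_, fun hadj => ?_⟩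
  · exact hne (eq_of_mem (Clique.single Γ x.1) (Finset.mem_singleton_self _)
      (Finset.mem_singleton.2 heq.symm))
  · exact hne (eq_of_mem (Clique.edge hadj) (by simp [Clique.edge]) (by simp [Clique.edge]))

theorem exists_of_proj_of_dvd {x : V × Bool} {w : FreeMonoid (V × Bool)}
    (h : proj Γ (of x) ∣ proj Γ w) :
    ∃ w', proj Γ w = proj Γ (of x * w') ∧ eval Γ w = eval Γ (of x * w') ∧
      w.length = w'.length + 1 := by
  induction w using FreeMonoid.inductionOn' with
  | one => exact absurd h (not_proj_of_dvd_one x)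
  | of_mul y w ih =>
    rw [map_mul] at h
    rcases eq_or_indep_of_dvd_mul h with rfl | hxy
    · exact ⟨w, rfl, rfl, by rw [length_mul, length_of, add_comm]⟩
    obtain ⟨w', hproj, heval, hlen⟩ := ih (hxy.proj_of_dvd_mul_iff.1 h)
    refine ⟨of y * w', ?_, ?_, by rw [length_mul, length_mul, hlen]; rfl⟩
    · simp only [map_mul, hproj, ← mul_assoc, hxy.commute_proj.eq]
    · simp only [map_mul, heval, ← mul_assoc, hxy.commute_eval.eq]

theorem eval_eq_of_proj_eq {w w' : FreeMonoid (V × Bool)} (h : proj Γ w = proj Γ w') :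
    eval Γ w = eval Γ w' := by
  induction w using FreeMonoid.inductionOn' generalizing w' with
  | one =>
    cases w' using FreeMonoid.casesOn with
    | one => rfl
    | of_mul x w' =>
      rw [map_one, map_mul] at h
      exact absurd ⟨_, h⟩ (not_proj_of_dvd_one x)
  | of_mul x w ih =>
    rw [map_mul] at h
    obtain ⟨w'', hproj, heval, -⟩ := exists_of_proj_of_dvd ⟨_, h.symm⟩
    rw [hproj, map_mul] at h
    rw [heval, map_mul, map_mul, ih (mul_left_cancel h)]

/-- The families of projections of words in which no letter can be brought next to its inverse. -/
inductive IsReducedFamily : (Clique Γ → FreeMonoid (V × Bool)) → Prop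
  | one : IsReducedFamily 1
  | of_mul (x : V × Bool) (s : Clique Γ → FreeMonoid (V × Bool)) (hs : IsReducedFamily s)
      (hx : ¬ proj Γ (of (letterInv x)) ∣ s) : IsReducedFamily (proj Γ (of x) * s)

theorem isReducedFamily_of_mul_iff {x : V × Bool} {s : Clique Γ → FreeMonoid (V × Bool)} :
    IsReducedFamily (proj Γ (of x) * s) ↔
      IsReducedFamily s ∧ ¬ proj Γ (of (letterInv x)) ∣ s := by
  refine ⟨fun h => ?_, fun h => .of_mul x s h.1 h.2⟩
  generalize ht : proj Γ (of x) * s = t at h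
  induction h generalizing s with
  | one => exact absurd ⟨s, ht.symm⟩ (not_proj_of_dvd_one x)
  | of_mul y t' ht' hy ih =>
    rcases eq_or_indep_of_dvd_mul ⟨s, ht.symm⟩ with rfl | hxy
    · obtain rfl := mul_left_cancel ht
      exact ⟨ht', hy⟩
    have hyx : Indep Γ (letterInv y) x := hxy.symm
    have hxy' : Indep Γ (letterInv x) y := hxy
    obtain ⟨q, rfl⟩ := hxy.proj_of_dvd_mul_iff.1 ⟨s, ht.symm⟩
    obtain rfl : s = proj Γ (of y) * q := mul_left_cancel (a := proj Γ (of x)) (by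
      rw [ht, ← mul_assoc, ← mul_assoc, hxy.commute_proj.eq])
    obtain ⟨hq, hxq⟩ := ih rfl
    exact ⟨.of_mul y q hq (mt hyx.proj_of_dvd_mul_iff.2 hy),
      mt hxy'.proj_of_dvd_mul_iff.1 hxq⟩

theorem IsReducedFamily.ne_of_mul_letterInv_mul {x : V × Bool}
    {s t : Clique Γ → FreeMonoid (V × Bool)} (ht : IsReducedFamily t) :
    t ≠ proj Γ (of x) * (proj Γ (of (letterInv x)) * s) := by
  rintro rfl
  exact (isReducedFamily_of_mul_iff.1 ht).2 (dvd_mul_right _ _)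

theorem IsReducedWord.isReducedFamily {w : FreeMonoid (V × Bool)}
    (hw : IsReducedWord Γ (toList w)) : IsReducedFamily (proj Γ w) := by
  induction w using FreeMonoid.inductionOn' with
  | one => rw [map_one]; exact .one
  | of_mul x w ih =>
    rw [map_mul]
    refine .of_mul x _ (ih hw.of_mul_right) fun hdvd => ?_
    obtain ⟨w', -, heval, hlen⟩ := exists_of_proj_of_dvd hdvd
    have hcancel : eval Γ w' = eval Γ (of x * w) := by
      rw [map_mul, heval, map_mul, eval_of_letterInv, mul_inv_cancel_left]
    have hle : (of x * w).length ≤ w'.length := hw (toList w') hcancel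
    rw [length_mul] at hle
    omega

/-- The type of reduced families of projections. -/
abbrev ReducedFamily (Γ : SimpleGraph V) : Type _ :=
  {s : Clique Γ → FreeMonoid (V × Bool) // IsReducedFamily s}

open Classical in
/-- Left multiplication by a letter on reduced families, with cancellation. -/
noncomputable def letterAct (x : V × Bool) (s : ReducedFamily Γ) : ReducedFamily Γ :=
  if h : proj Γ (of (letterInv x)) ∣ s.1 then
    ⟨h.choose, (isReducedFamily_of_mul_iff.1 (h.choose_spec ▸ s.2)).1⟩
  else ⟨proj Γ (of x) * s.1, .of_mul x s.1 s.2 h⟩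

section LetterAct

variable {x y : V × Bool} {s t : ReducedFamily Γ}

theorem letterAct_eq_iff :
    letterAct x s = t ↔ s.1 = proj Γ (of (letterInv x)) * t.1 ∨ t.1 = proj Γ (of x) * s.1 := by
  constructor
  · rintro rfl
    rw [letterAct]
    split_ifs with h
    · exact Or.inl h.choose_spec
    · exact Or.inr rfl
  · rintro (h | h)
    · have hdvd : proj Γ (of (letterInv x)) ∣ s.1 := ⟨_, h⟩
      rw [letterAct, dif_pos hdvd]
      exact Subtype.ext (mul_left_cancel (hdvd.choose_spec.symm.trans h))
    · have hred : IsReducedFamily (proj Γ (of x) * s.1) := h ▸ t.2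
      rw [letterAct, dif_neg (isReducedFamily_of_mul_iff.1 hred).2]
      exact Subtype.ext h.symm

theorem letterAct_letterInv : letterAct (letterInv x) (letterAct x s) = s := by
  rw [letterAct_eq_iff, letterInv_letterInv]
  exact (letterAct_eq_iff.1 rfl).symm

theorem letterAct_comm (h : Indep Γ x y) :
    letterAct x (letterAct y s) = letterAct y (letterAct x s) := by
  obtain ⟨p, hp⟩ : ∃ p, letterAct y s = p := ⟨_, rfl⟩
  obtain ⟨q, hq⟩ : ∃ q, letterAct x s = q := ⟨_, rfl⟩
  obtain ⟨t, ht⟩ : ∃ t, letterAct x p = t := ⟨_, rfl⟩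
  rw [hp, hq, ht, eq_comm, letterAct_eq_iff]
  have hxy' : Indep Γ x (letterInv y) := h
  have hx'y : Indep Γ (letterInv x) y := h
  have hx'y' : Indep Γ (letterInv x) (letterInv y) := h
  rcases letterAct_eq_iff.1 hp with hp | hp <;> rcases letterAct_eq_iff.1 hq with hq | hq <;>
    rcases letterAct_eq_iff.1 ht with ht | ht
  · left
    refine mul_left_cancel (a := proj Γ (of (letterInv x))) ?_
    rw [← hq, hp, ht, hx'y'.commute_proj.left_comm]
  · obtain ⟨r, hr⟩ := hx'y'.proj_of_dvd_mul_iff.1 ⟨q.1, hp.symm.trans hq⟩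
    exact absurd (hr ▸ ht) t.2.ne_of_mul_letterInv_mul
  · rw [hp, ht, hx'y'.commute_proj.symm.left_comm] at hq
    exact absurd hq q.2.ne_of_mul_letterInv_mul
  · left
    rw [hq, ht, hp, hxy'.commute_proj.left_comm]
  · right
    refine mul_left_cancel (a := proj Γ (of (letterInv x))) ?_
    rw [← ht, hp, hq, hx'y.commute_proj.left_comm]
  · rw [hp, hq, ← hx'y.commute_proj.left_comm] at ht
    exact absurd ht t.2.ne_of_mul_letterInv_mul
  · obtain ⟨r, hr⟩ := hx'y.proj_of_dvd_mul_iff.1 ⟨t.1, hp.symm.trans ht⟩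
    exact absurd (hr ▸ hq) q.2.ne_of_mul_letterInv_mul
  · right
    rw [ht, hp, hq, h.commute_proj.left_comm]

end LetterAct

/-- Left multiplication by a vertex, as a permutation of the reduced families. -/
noncomputable def vertexPerm (Γ : SimpleGraph V) (v : V) :
    Equiv.Perm (ReducedFamily Γ) where
  toFun := letterAct (v, true)
  invFun := letterAct (v, false)
  left_inv _ := letterAct_letterInv (x := (v, true))
  right_inv _ := letterAct_letterInv (x := (v, false))

/-- The action of `G(Γ)` on the reduced families by left multiplication. The orbit map of `1` sends
each element to the family of projections of its reduced words. -/
noncomputable def actHom (Γ : SimpleGraph V) :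
    Grp Γ →* Equiv.Perm (ReducedFamily Γ) :=
  PresentedGroup.toGroup (f := vertexPerm Γ) (by
    rintro r ⟨u, v, huv, rfl⟩
    simp only [map_mul, map_inv, FreeGroup.lift_apply_of]
    rw [mul_inv_eq_one, mul_inv_eq_iff_eq_mul]
    rcases eq_or_ne u v with rfl | hne
    · rfl
    · exact Equiv.ext fun s => letterAct_comm (x := (u, true)) (y := (v, true)) ⟨hne, huv⟩)

theorem actHom_eval_of (x : V × Bool) (s : ReducedFamily Γ) :
    actHom Γ (eval Γ (of x)) s = letterAct x s := by
  have h (v : V) : actHom Γ (gen Γ v) = vertexPerm Γ v := PresentedGroup.toGroup.of _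
  obtain ⟨v, _ | _⟩ := x
  · rw [eval_of_false, map_inv, h]
    rfl
  · rw [eval_of_true, h]
    rfl

theorem IsReducedWord.actHom_eval_one {w : FreeMonoid (V × Bool)}
    (hw : IsReducedWord Γ (toList w)) : (actHom Γ (eval Γ w) ⟨1, .one⟩).1 = proj Γ w := by
  induction w using FreeMonoid.inductionOn' with
  | one => simp only [map_one, Equiv.Perm.one_apply]
  | of_mul x w ih =>
    have hw' := hw.of_mul_right
    have hx : letterAct x ⟨proj Γ w, hw'.isReducedFamily⟩ =
        ⟨proj Γ (of x * w), hw.isReducedFamily⟩ := letterAct_eq_iff.2 (Or.inr (map_mul _ _ _))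
    have hact : actHom Γ (eval Γ w) ⟨1, .one⟩ = ⟨proj Γ w, hw'.isReducedFamily⟩ :=
      Subtype.ext (ih hw')
    rw [map_mul, map_mul, Equiv.Perm.mul_apply, actHom_eval_of, hact, hx]

theorem IsReducedWord.proj_eq {w w' : FreeMonoid (V × Bool)} (hw : IsReducedWord Γ (toList w))
    (hw' : IsReducedWord Γ (toList w')) (h : eval Γ w = eval Γ w') : proj Γ w = proj Γ w' := by
  rw [← hw.actHom_eval_one, h, hw'.actHom_eval_one]

end Projection

/-! ### Vertex counts, roots and supports -/

section VertexCount

variable {V : Type*} {Γ : SimpleGraph V} [DecidableEq V]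

/-- The number of letters over the vertex `v` in a word. -/
def vertexCount (v : V) (w : FreeMonoid (V × Bool)) : ℕ := w.countP' fun x => x.1 = v

theorem vertexCount_mul (v : V) (w w' : FreeMonoid (V × Bool)) :
    vertexCount v (w * w') = vertexCount v w + vertexCount v w' :=
  countP'_mul _ w w'

theorem vertexCount_pow (v : V) (w : FreeMonoid (V × Bool)) (n : ℕ) :
    vertexCount v (w ^ n) = n * vertexCount v w :=
  countP'_pow _ w n

theorem vertexCount_of (v : V) (x : V × Bool) :
    vertexCount v (of x) = if x.1 = v then 1 else 0 := by
  simp only [vertexCount, countP', toList_of, List.countP_singleton, decide_eq_true_eq]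

theorem vertexCount_reverse (v : V) (w : FreeMonoid (V × Bool)) :
    vertexCount v (reverse w) = vertexCount v w :=
  List.countP_reverse

theorem vertexCount_le_of_dvd {w w' : FreeMonoid (V × Bool)} (h : w ∣ w') (v : V) :
    vertexCount v w ≤ vertexCount v w' := by
  obtain ⟨r, rfl⟩ := h
  exact (vertexCount_mul v w r).symm ▸ Nat.le_add_right _ _

theorem vertexCount_pos_iff {v : V} {w : FreeMonoid (V × Bool)} :
    0 < vertexCount v w ↔ ∃ ε, (v, ε) ∈ toList w := by
  simp [vertexCount, countP', List.countP_pos_iff]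

theorem sum_vertexCount (S : Finset V) (w : FreeMonoid (V × Bool)) :
    ∑ v ∈ S, vertexCount v w = w.countP' fun x => x.1 ∈ S := by
  induction w using FreeMonoid.inductionOn' with
  | one => exact Finset.sum_const_zero
  | of_mul x w ih =>
    simp only [vertexCount_mul, Finset.sum_add_distrib, ih, countP'_mul, vertexCount_of,
      Finset.sum_ite_eq]
    simp [countP']

theorem sum_univ_vertexCount [Fintype V] (w : FreeMonoid (V × Bool)) :
    ∑ v, vertexCount v w = w.length := by
  simp [sum_vertexCount, countP', FreeMonoid.length]

theorem toList_proj_apply (w : FreeMonoid (V × Bool)) (K : Clique Γ) :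
    toList (proj Γ w K) = (toList w).filter fun x => x.1 ∈ K.1 := by
  induction w using FreeMonoid.inductionOn' with
  | one => rfl
  | of_mul x w ih =>
    rw [map_mul, Pi.mul_apply, toList_mul, ih, proj_of_apply, toList_mul, List.filter_append,
      toList_of]
    split_ifs with h <;> simp [h]

theorem vertexCount_proj {v : V} {K : Clique Γ} (hv : v ∈ K.1) (w : FreeMonoid (V × Bool)) :
    vertexCount v (proj Γ w K) = vertexCount v w := by
  rw [vertexCount, countP', toList_proj_apply, List.countP_filter]
  refine List.countP_congr fun x _ => ?_
  simp only [Bool.and_eq_true, decide_eq_true_eq, and_iff_left_iff_imp]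
  rintro rfl
  exact hv

theorem length_proj (w : FreeMonoid (V × Bool)) (K : Clique Γ) :
    (proj Γ w K).length = ∑ v ∈ K.1, vertexCount v w := by
  rw [sum_vertexCount, FreeMonoid.length, toList_proj_apply, ← List.countP_eq_length_filter,
    countP']

theorem length_proj_single (w : FreeMonoid (V × Bool)) (v : V) :
    (proj Γ w (Clique.single Γ v)).length = vertexCount v w := by
  rw [length_proj, Clique.single, Finset.sum_singleton]

theorem proj_reverse_apply (w : FreeMonoid (V × Bool)) (K : Clique Γ) :
    proj Γ (reverse w) K = reverse (proj Γ w K) := by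
  apply toList.injective
  rw [toList_proj_apply]
  exact (List.filter_reverse ..).trans (congrArg List.reverse (toList_proj_apply w K).symm)

theorem exists_proj_eq_of_proj_eq_mul {g : FreeMonoid (V × Bool)}
    {w t : Clique Γ → FreeMonoid (V × Bool)} (h : proj Γ g = w * t)
    (hw : ∀ (v : V) (K L : Clique Γ), v ∈ K.1 → v ∈ L.1 →
      vertexCount v (w K) = vertexCount v (w L)) :
    ∃ u, proj Γ u = w := by
  induction g using FreeMonoid.inductionOn' generalizing w t with
  | one =>
    exact ⟨1, funext fun K => (List.append_eq_nil_iff.1 (congrFun h K).symm).1.symm⟩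
  | of_mul x g ih =>
    rw [map_mul] at h
    have hdvd : proj Γ (of x) ∣ w * t := ⟨_, h.symm⟩
    by_cases hx : proj Γ (of x) ∣ w
    · obtain ⟨w', rfl⟩ := hx
      rw [mul_assoc] at h
      obtain ⟨u, rfl⟩ := ih (mul_left_cancel h) fun v K L hvK hvL => by
        simpa only [Pi.mul_apply, vertexCount_mul, vertexCount_proj, hvK, hvL,
          Nat.add_left_cancel_iff] using hw v K L hvK hvL
      exact ⟨of x * u, map_mul _ _ _⟩
    · have eq_one_or (K : Clique Γ) (hxK : x.1 ∈ K.1) : w K = 1 ∨ of x ∣ w K :=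
        eq_one_or_of_dvd (proj_of_dvd_iff.1 hdvd K hxK)
      obtain ⟨K, hxK, hK⟩ : ∃ K : Clique Γ, x.1 ∈ K.1 ∧ ¬ of x ∣ w K := by
        simpa only [proj_of_dvd_iff, not_forall, exists_prop] using hx
      have hone (L : Clique Γ) (hxL : x.1 ∈ L.1) : w L = 1 := by
        refine (eq_one_or L hxL).resolve_right fun hd => ?_
        have hle := vertexCount_le_of_dvd hd x.1
        rw [hw x.1 L K hxL hxK, (eq_one_or K hxK).resolve_right hK, vertexCount_of,
          if_pos rfl] at hle
        exact absurd hle (Nat.not_succ_le_zero 0)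
      obtain ⟨t', rfl⟩ := (proj_of_dvd_mul_iff hone).1 hdvd
      rw [← (commute_proj_of hone).left_comm] at h
      exact ih (mul_left_cancel h) hw

theorem exists_eval_eq_pow {g : FreeMonoid (V × Bool)} {s : ℕ} (hs : s ≠ 0)
    (h : ∀ K, ∃ w, proj Γ g K = w ^ s) : ∃ u, eval Γ g = u ^ s := by
  choose w hw using h
  replace hw : proj Γ g = w ^ s := funext hw
  obtain ⟨u, rfl⟩ : ∃ u, proj Γ u = w := by
    refine exists_proj_eq_of_proj_eq_mul (g := g) (t := w ^ (s - 1)) ?_ fun v K L hvK hvL => ?_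
    · rw [hw, mul_pow_sub_one hs]
    · refine Nat.eq_of_mul_eq_mul_left (Nat.pos_of_ne_zero hs) ?_
      rw [← vertexCount_pow, ← vertexCount_pow, ← Pi.pow_apply, ← Pi.pow_apply, ← hw,
        vertexCount_proj hvK, vertexCount_proj hvL]
  rw [← map_pow] at hw
  exact ⟨eval Γ u, (eval_eq_of_proj_eq hw).trans (map_pow _ _ _)⟩

theorem IsPrimitive.eq_one_of_proj {g : FreeMonoid (V × Bool)} (hg : IsPrimitive (eval Γ g))
    {s : ℕ} (hs : s ≠ 0) (h : ∀ K, ∃ w, proj Γ g K = w ^ s) : s = 1 := by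
  by_contra hne
  obtain ⟨u, hu⟩ := exists_eval_eq_pow hs h
  exact hg.2 ⟨u, s, by omega, hu⟩

/-- The set of vertices occurring in a word. -/
def wordSupp (w : FreeMonoid (V × Bool)) : Set V := {v | 0 < vertexCount v w}

theorem wordSupp_reverse (w : FreeMonoid (V × Bool)) : wordSupp (reverse w) = wordSupp w := by
  simp only [wordSupp, vertexCount_reverse]

theorem IsReducedWord.supp_eval {w : FreeMonoid (V × Bool)} (hw : IsReducedWord Γ (toList w)) :
    supp (eval Γ w) = wordSupp w := by
  ext v
  constructor
  · rintro ⟨w', hw', h, hv⟩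
    have hproj : proj Γ (ofList w') = proj Γ w := IsReducedWord.proj_eq hw' hw h
    rw [wordSupp, Set.mem_ofPred_eq, ← length_proj_single (Γ := Γ), ← hproj, length_proj_single]
    exact vertexCount_pos_iff.2 hv
  · intro hv
    exact ⟨toList w, hw, rfl, vertexCount_pos_iff.1 hv⟩

omit [DecidableEq V] in
theorem supp_gen_subset (v : V) : supp (gen Γ v) ⊆ {v} := by
  classical
  rintro u hu
  obtain ⟨w, hw, h, ε, hmem⟩ := id hu
  have hred : IsReducedWord Γ (toList (of (v, true))) := fun w' hw' =>
    (List.length_pos_of_mem hmem).trans_le (hw w' (hw'.trans h.symm))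
  rw [← eval_of_true, hred.supp_eval, wordSupp, Set.mem_ofPred_eq, vertexCount_of] at hu
  by_contra hne
  rw [if_neg (Ne.symm hne)] at hu
  exact lt_irrefl 0 hu

/-- `S` spans a connected subgraph, and every vertex outside `S` has a neighbour in `S`. -/
structure IsConnectedDominating (Γ : SimpleGraph V) (S : Set V) : Prop where
  connected : (Γ.induce S).Connected
  exists_adj : ∀ v ∉ S, ∃ u ∈ S, Γ.Adj v u

omit [DecidableEq V] in
theorem StronglyNonSplit.isConnectedDominating_supp {g : Grp Γ} (hg : StronglyNonSplit g) :
    IsConnectedDominating Γ (supp g) where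
  connected := hg.1
  exists_adj v hv := by
    by_contra! hadj
    refine hg.2 ⟨v, Set.disjoint_left.2 fun u hu => ?_, fun u hu => ?_⟩
    · obtain rfl := supp_gen_subset v hu
      exact hv
    · obtain rfl := supp_gen_subset v hu
      exact hadj

end VertexCount

/-! ### Paths through a connected dominating set -/

section Dominating

variable {V : Type*} {Γ : SimpleGraph V} {S : Set V}

namespace IsConnectedDominating

theorem exists_walk_to (hS : IsConnectedDominating Γ S) (v : V) :
    ∃ s ∈ S, ∃ p : Γ.Walk v s, ∀ w ∈ p.support, w = v ∨ w ∈ S := by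
  by_cases hv : v ∈ S
  · exact ⟨v, hv, .nil, by simp⟩
  · obtain ⟨s, hs, hadj⟩ := hS.exists_adj v hv
    exact ⟨s, hs, hadj.toWalk, by simp [hs]⟩

theorem exists_isPath (hS : IsConnectedDominating Γ S) (u v : V) :
    ∃ p : Γ.Walk u v, p.IsPath ∧ ∀ w ∈ p.support, w = u ∨ w = v ∨ w ∈ S := by
  classical
  obtain ⟨s, hs, p, hp⟩ := hS.exists_walk_to u
  obtain ⟨t, ht, q, hq⟩ := hS.exists_walk_to v
  obtain ⟨r, hr⟩ : ∃ r : Γ.Walk s t, ∀ w ∈ r.support, w ∈ S := by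
    obtain ⟨r⟩ := hS.connected ⟨s, hs⟩ ⟨t, ht⟩
    refine ⟨r.map (SimpleGraph.Embedding.induce S).toHom, fun w hw => ?_⟩
    obtain ⟨x, -, rfl⟩ := List.mem_map.1 (SimpleGraph.Walk.support_map _ r ▸ hw)
    exact x.2
  refine ⟨((p.append r).append q.reverse).bypass, SimpleGraph.Walk.bypass_isPath _,
    fun w hw => ?_⟩
  have hmem := SimpleGraph.Walk.support_bypass_subset_support _ hw
  simp only [SimpleGraph.Walk.mem_support_append_iff, SimpleGraph.Walk.support_reverse,
    List.mem_reverse] at hmem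
  rcases hmem with (hw | hw) | hw
  · exact (hp w hw).imp_right Or.inr
  · exact Or.inr (Or.inr (hr w hw))
  · exact Or.inr (hq w hw)

end IsConnectedDominating

end Dominating

/-! ### Prefixes of a word containing a run -/

section Prefix

variable {V : Type*} {Γ : SimpleGraph V} [DecidableEq V]
  {s : Clique Γ → FreeMonoid (V × Bool)} {a g c : FreeMonoid (V × Bool)} {n : ℕ}

theorem vertexCount_le_of_adj {p c : FreeMonoid (V × Bool)} (hp : proj Γ p ∣ s)
    (hc : proj Γ c ∣ s) {u v : V} (hadj : Γ.Adj v u) (hlt : vertexCount v p < vertexCount v c) :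
    vertexCount u p ≤ vertexCount u c := by
  let K := Clique.edge hadj
  have hv : v ∈ K.1 := Finset.mem_insert_self v {u}
  have hu : u ∈ K.1 := Finset.mem_insert_of_mem (Finset.mem_singleton_self u)
  rcases le_total (proj Γ p K).length (proj Γ c K).length with hl | hl
  · have := vertexCount_le_of_dvd
      (dvd_of_dvd_of_length_le (pi_dvd_iff.1 hp K) (pi_dvd_iff.1 hc K) hl) u
    rwa [vertexCount_proj hu, vertexCount_proj hu] at this
  · have := vertexCount_le_of_dvd
      (dvd_of_dvd_of_length_le (pi_dvd_iff.1 hc K) (pi_dvd_iff.1 hp K) hl) v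
    rw [vertexCount_proj hv, vertexCount_proj hv] at this
    exact absurd this hlt.not_ge

theorem vertexCount_mul_pow_le {i j : ℕ} (hij : i ≤ j) (v : V) :
    vertexCount v (a * g ^ i) ≤ vertexCount v (a * g ^ j) :=
  vertexCount_le_of_dvd (mul_dvd_mul_left a (pow_dvd_pow g hij)) v

/-- Each step along the path costs one factor `g`, since the letters over a vertex of `wordSupp g`
occur in `g`. -/
theorem vertexCount_le_of_isPath (hs : proj Γ (a * g ^ n) ∣ s) (hc : proj Γ c ∣ s) {j d : ℕ}
    (hn : j + d ≤ n) {u v : V} (p : Γ.Walk v u) (hp : p.IsPath) (hl : p.length ≤ d + 1)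
    (hsupp : ∀ w ∈ p.support, w = v ∨ w = u ∨ w ∈ wordSupp g)
    (hlt : vertexCount v (a * g ^ (j + d)) < vertexCount v c) :
    vertexCount u (a * g ^ j) ≤ vertexCount u c := by
  induction p generalizing d with
  | nil => exact (vertexCount_mul_pow_le (j.le_add_right d) _).trans hlt.le
  | @cons v w u hadj p ih =>
    have hdvd : proj Γ (a * g ^ (j + d)) ∣ s :=
      (map_dvd _ (mul_dvd_mul_left a (pow_dvd_pow g hn))).trans hs
    have hle := vertexCount_le_of_adj hdvd hc hadj hlt
    rw [SimpleGraph.Walk.cons_isPath_iff] at hp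
    rcases eq_or_ne w u with rfl | hwu
    · exact (vertexCount_mul_pow_le (j.le_add_right d) _).trans hle
    have hvp {x : V} (hx : x ∈ p.support) : x ≠ v := fun h => hp.2 (h ▸ hx)
    have hwg : w ∈ wordSupp g :=
      ((hsupp w (by simp)).resolve_left (hvp p.start_mem_support)).resolve_left hwu
    have hpos : 0 < p.length := Nat.pos_of_ne_zero fun h0 => hwu (p.eq_of_length_eq_zero h0)
    rw [SimpleGraph.Walk.length_cons] at hl
    obtain ⟨d, rfl⟩ : ∃ d', d = d' + 1 := ⟨d - 1, by omega⟩
    refine ih (d := d) (by omega) hp.1 (by omega) (fun x hx => ?_) ?_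
    · exact Or.inr ((hsupp x (by simp [hx])).resolve_left (hvp hx))
    · refine lt_of_lt_of_le ?_ hle
      have hpos : 0 < vertexCount w g := hwg
      rw [← add_assoc, pow_succ g (j + d), ← mul_assoc, vertexCount_mul _ _ g]
      exact Nat.lt_add_of_pos_right hpos

theorem length_pos_of_wordSupp_nonempty (h : (wordSupp g).Nonempty) : 0 < g.length := by
  obtain ⟨v, hv⟩ := h
  obtain ⟨ε, hmem⟩ := vertexCount_pos_iff.1 hv
  exact List.length_pos_of_mem hmem

variable [Fintype V]

theorem vertexCount_le_of_lt (hS : IsConnectedDominating Γ (wordSupp g))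
    (hs : proj Γ (a * g ^ n) ∣ s) (hc : proj Γ c ∣ s) {j d : ℕ} (hn : j + d ≤ n)
    (hd : Fintype.card V ≤ d + 2) {v : V}
    (hlt : vertexCount v (a * g ^ (j + d)) < vertexCount v c) (u : V) :
    vertexCount u (a * g ^ j) ≤ vertexCount u c := by
  obtain ⟨p, hp, hsupp⟩ := hS.exists_isPath v u
  have hl := hp.length_lt
  exact vertexCount_le_of_isPath hs hc hn p hp (by omega) hsupp hlt

theorem exists_length_proj_le (hS : IsConnectedDominating Γ (wordSupp g))
    (hs : proj Γ (a * g ^ n) ∣ s) (hc : proj Γ c ∣ s) {d : ℕ} (hd : Fintype.card V ≤ d + 2)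
    (hl : max a.length c.length + (d + 1) * g.length ≤ a.length + n * g.length) :
    ∃ m, a.length + m * g.length ≤ max a.length c.length ∧
      ∀ K, (proj Γ c K).length ≤ (proj Γ a K).length + (m + d + 1) * (proj Γ g K).length := by
  have hpos : 0 < g.length :=
    length_pos_of_wordSupp_nonempty (Set.nonempty_coe_sort.1 hS.connected.nonempty)
  obtain ⟨m, hle, hlt⟩ : ∃ m, a.length + m * g.length ≤ max a.length c.length ∧
      max a.length c.length < a.length + (m + 1) * g.length := by
    refine ⟨(max a.length c.length - a.length) / g.length, ?_, ?_⟩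
    · have := Nat.div_mul_le_self (max a.length c.length - a.length) g.length
      omega
    · have := Nat.lt_mul_div_succ (max a.length c.length - a.length) hpos
      rw [mul_comm] at this
      omega
  have hmn : m + 1 + d ≤ n := Nat.le_of_mul_le_mul_right (by linarith) hpos
  have hcount (v : V) : vertexCount v c ≤ vertexCount v (a * g ^ (m + 1 + d)) := by
    by_contra! hv
    have hsum := Finset.sum_le_sum fun u (_ : u ∈ Finset.univ) =>
      vertexCount_le_of_lt hS hs hc hmn hd hv u
    rw [sum_univ_vertexCount, sum_univ_vertexCount, length_mul, length_pow] at hsum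
    omega
  refine ⟨m, hle, fun K => ?_⟩
  have hsum := Finset.sum_le_sum fun u (_ : u ∈ K.1) => hcount u
  rwa [← length_proj, ← length_proj, map_mul, map_pow, Pi.mul_apply, Pi.pow_apply, length_mul,
    length_pow, Nat.add_right_comm] at hsum

theorem exists_length_proj_le_right {b e x y : FreeMonoid (V × Bool)}
    (hS : IsConnectedDominating Γ (wordSupp g))
    (h : proj Γ (x * g ^ n * b) = proj Γ (y * e)) {d : ℕ} (hd : Fintype.card V ≤ d + 2)
    (hl : max b.length e.length + (d + 1) * g.length ≤ b.length + n * g.length) :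
    ∃ m, b.length + m * g.length ≤ max b.length e.length ∧
      ∀ K, (proj Γ e K).length ≤ (proj Γ b K).length + (m + d + 1) * (proj Γ g K).length := by
  have hrev : proj Γ (reverse (x * g ^ n * b)) = proj Γ (reverse (y * e)) :=
    funext fun K => by rw [proj_reverse_apply, proj_reverse_apply, h]
  rw [reverse_mul, reverse_mul, reverse_mul, reverse_pow, ← mul_assoc] at hrev
  rw [← wordSupp_reverse] at hS
  have hs : proj Γ (reverse b * reverse g ^ n) ∣ proj Γ (reverse b * reverse g ^ n * reverse x) :=
    map_dvd _ (dvd_mul_right _ _)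
  have hc : proj Γ (reverse e) ∣ proj Γ (reverse b * reverse g ^ n * reverse x) :=
    hrev ▸ map_dvd _ (dvd_mul_right _ _)
  simpa only [proj_reverse_apply, length_reverse] using
    exists_length_proj_le hS hs hc hd (by simpa only [length_reverse] using hl)

theorem length_proj_le_of_proj_eq {b y e : FreeMonoid (V × Bool)}
    (hS : IsConnectedDominating Γ (wordSupp g))
    (h : proj Γ (a * g ^ n * b) = proj Γ (c * y * e))
    (hl : max a.length c.length + max b.length e.length + 2 * Fintype.card V * g.length ≤
      (a * g ^ n * b).length) (K : Clique Γ) :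
    max (proj Γ a K).length (proj Γ c K).length + max (proj Γ b K).length (proj Γ e K).length +
      2 * (proj Γ g K).length ≤ (proj Γ (a * g ^ n * b) K).length := by
  have hsupp : (wordSupp g).Nonempty := Set.nonempty_coe_sort.1 hS.connected.nonempty
  rcases lt_or_ge 1 (Fintype.card V) with hV | hV
  · obtain ⟨d, hd⟩ : ∃ d, Fintype.card V = d + 2 := ⟨Fintype.card V - 2, by omega⟩
    rw [hd, length_mul, length_mul, length_pow] at hl
    obtain ⟨m, hm, hmK⟩ := exists_length_proj_le (s := proj Γ (a * g ^ n * b)) (c := c) (d := d)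
      hS (map_dvd _ (dvd_mul_right _ _)) (h ▸ map_dvd _ (mul_assoc c y e ▸ dvd_mul_right _ _))
      hd.le (by nlinarith [le_max_left b.length e.length])
    obtain ⟨m', hm', hmK'⟩ := exists_length_proj_le_right (d := d) hS h hd.le
      (by nlinarith [le_max_left a.length c.length])
    have hn : m + m' + 2 * (d + 2) ≤ n :=
      Nat.le_of_mul_le_mul_right (by linarith) (length_pos_of_wordSupp_nonempty hsupp)
    have hnK := Nat.mul_le_mul_right (proj Γ g K).length hn
    simp only [map_mul, map_pow, Pi.mul_apply, Pi.pow_apply, length_mul, length_pow]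
    have hmax := max_le (Nat.le_add_right _ _) (hmK K)
    have hmax' := max_le (Nat.le_add_right _ _) (hmK' K)
    linarith
  · have : Subsingleton V := Fintype.card_le_one_iff_subsingleton.1 hV
    rcases K.1.eq_empty_or_nonempty with hK | hK
    · simp [length_proj, hK]
    · simp only [length_proj, hK.eq_univ, sum_univ_vertexCount]
      have hV' : 1 ≤ Fintype.card V := Fintype.card_pos_iff.2 ⟨hsupp.some⟩
      nlinarith

end Prefix

/-! ### Comparison of the two runs -/

theorem mul_eq_mul_of_preconnected {V : Type*} {Γ : SimpleGraph V} (hΓ : Γ.Preconnected)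
    {f₁ f₂ : V → ℕ} (hpos : ∀ v, 0 < f₁ v)
    (hadj : ∀ ⦃u v⦄, Γ.Adj u v → f₁ u * f₂ v = f₂ u * f₁ v) (u v : V) :
    f₁ u * f₂ v = f₂ u * f₁ v := by
  obtain ⟨p⟩ := hΓ u v
  induction p with
  | nil => exact mul_comm _ _
  | @cons u w v h _ ih =>
    refine Nat.eq_of_mul_eq_mul_left (hpos w) ?_
    calc f₁ w * (f₁ u * f₂ v) = f₁ u * (f₁ w * f₂ v) := mul_left_comm _ _ _
      _ = f₁ u * f₂ w * f₁ v := by rw [ih, mul_assoc]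
      _ = f₁ w * (f₂ u * f₁ v) := by rw [hadj h]; ring

section CliqueOverlap

variable {V : Type*} {Γ : SimpleGraph V} [DecidableEq V]
  {a₁ g₁ b₁ a₂ g₂ b₂ : FreeMonoid (V × Bool)} {n₁ n₂ : ℕ}

/-- The runs `g₁ ^ n₁` and `g₂ ^ n₂` overlap in the projection to every clique. -/
def CliqueOverlap (Γ : SimpleGraph V) (a₁ g₁ b₁ a₂ g₂ b₂ : FreeMonoid (V × Bool))
    (n₁ n₂ : ℕ) : Prop :=
  ∀ K : Clique Γ, Overlap (proj Γ a₁ K) (proj Γ g₁ K) (proj Γ b₁ K)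
    (proj Γ a₂ K) (proj Γ g₂ K) (proj Γ b₂ K) n₁ n₂

namespace CliqueOverlap

theorem of_length_le [Fintype V] (hS₁ : IsConnectedDominating Γ (wordSupp g₁))
    (hS₂ : IsConnectedDominating Γ (wordSupp g₂))
    (h : proj Γ (a₁ * g₁ ^ n₁ * b₁) = proj Γ (a₂ * g₂ ^ n₂ * b₂))
    (hl₁ : max a₁.length a₂.length + max b₁.length b₂.length + 2 * Fintype.card V * g₁.length ≤
      (a₁ * g₁ ^ n₁ * b₁).length)
    (hl₂ : max a₁.length a₂.length + max b₁.length b₂.length + 2 * Fintype.card V * g₂.length ≤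
      (a₂ * g₂ ^ n₂ * b₂).length) :
    CliqueOverlap Γ a₁ g₁ b₁ a₂ g₂ b₂ n₁ n₂ := by
  intro K
  have hK : proj Γ (a₁ * g₁ ^ n₁ * b₁) K = proj Γ (a₂ * g₂ ^ n₂ * b₂) K := congrFun h K
  have hle₁ := length_proj_le_of_proj_eq hS₁ h hl₁ K
  have hle₂ := length_proj_le_of_proj_eq hS₂ h.symm
    (by rwa [max_comm a₂.length, max_comm b₂.length]) K
  rw [← hK] at hle₂
  simp only [map_mul, map_pow, Pi.mul_apply, Pi.pow_apply] at hK hle₁ hle₂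
  exact ⟨hK, by omega⟩

theorem symm (h : CliqueOverlap Γ a₁ g₁ b₁ a₂ g₂ b₂ n₁ n₂) :
    CliqueOverlap Γ a₂ g₂ b₂ a₁ g₁ b₁ n₂ n₁ :=
  fun K => (h K).symm

theorem wordSupp_subset (h : CliqueOverlap Γ a₁ g₁ b₁ a₂ g₂ b₂ n₁ n₂) :
    wordSupp g₂ ⊆ wordSupp g₁ := by
  intro v hv
  have hle := (h (Clique.single Γ v)).length_add_length_le
  rw [length_proj_single, length_proj_single] at hle
  refine Nat.pos_of_ne_zero fun h0 => ?_
  rw [h0] at hle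
  exact absurd (Nat.le_of_add_left_le hle) (Nat.not_le_of_gt hv)

theorem vertexCount_mul_vertexCount (h : CliqueOverlap Γ a₁ g₁ b₁ a₂ g₂ b₂ n₁ n₂) {u v : V}
    (hadj : Γ.Adj u v) :
    vertexCount u g₁ * vertexCount v g₂ = vertexCount u g₂ * vertexCount v g₁ := by
  have hu : u ∈ (Clique.edge hadj).1 := Finset.mem_insert_self u {v}
  have hv : v ∈ (Clique.edge hadj).1 := Finset.mem_insert_of_mem (Finset.mem_singleton_self v)
  have hmul := (h (Clique.edge hadj)).countP'_mul_countP' (fun x => x.1 = u) (fun x => x.1 = v)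
  simp only [← vertexCount.eq_def] at hmul
  rwa [vertexCount_proj hu, vertexCount_proj hv, vertexCount_proj hu, vertexCount_proj hv] at hmul

theorem exists_coprime (h : CliqueOverlap Γ a₁ g₁ b₁ a₂ g₂ b₂ n₁ n₂)
    (hc : (Γ.induce (wordSupp g₁)).Connected) :
    ∃ s t : ℕ, s ≠ 0 ∧ t ≠ 0 ∧ s.Coprime t ∧
      ∀ v, vertexCount v g₁ * t = vertexCount v g₂ * s := by
  obtain ⟨v₀, hv₀⟩ := hc.nonempty
  have hv₀' : 0 < vertexCount v₀ g₂ := h.symm.wordSupp_subset hv₀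
  have hcross (v : V) :
      vertexCount v g₁ * vertexCount v₀ g₂ = vertexCount v g₂ * vertexCount v₀ g₁ := by
    by_cases hv : v ∈ wordSupp g₁
    · exact mul_eq_mul_of_preconnected (f₁ := fun v : wordSupp g₁ => vertexCount v.1 g₁)
        (f₂ := fun v => vertexCount v.1 g₂) hc.preconnected (fun v => v.2)
        (fun _ _ hadj => h.vertexCount_mul_vertexCount hadj) ⟨v, hv⟩ ⟨v₀, hv₀⟩
    · have hv₂ : v ∉ wordSupp g₂ := fun hv₂ => hv (h.wordSupp_subset hv₂)
      rw [Nat.eq_zero_of_not_pos hv, Nat.eq_zero_of_not_pos hv₂, zero_mul, zero_mul]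
  obtain ⟨m, s, t, hm, hst, hs, ht⟩ :=
    Nat.exists_coprime' (Nat.gcd_pos_of_pos_left (vertexCount v₀ g₂) hv₀)
  rw [hs, ht] at hcross
  refine ⟨s, t, ?_, ?_, hst, fun v => Nat.eq_of_mul_eq_mul_right hm ?_⟩
  · rintro rfl
    exact hv₀.ne' (hs.trans (zero_mul m))
  · rintro rfl
    exact hv₀'.ne' (ht.trans (zero_mul m))
  · rw [mul_assoc, mul_assoc, hcross]

theorem eq_one_of_isPrimitive (h : CliqueOverlap Γ a₁ g₁ b₁ a₂ g₂ b₂ n₁ n₂)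
    (hp : IsPrimitive (eval Γ g₁)) {s t : ℕ} (hs : s ≠ 0) (hst : s.Coprime t)
    (hcount : ∀ v, vertexCount v g₁ * t = vertexCount v g₂ * s) : s = 1 :=
  hp.eq_one_of_proj hs fun K => (h K).exists_root hst (by
    simp only [length_proj, Finset.sum_mul, hcount])

theorem eval_pow_succ_eq (h : CliqueOverlap Γ a₁ g₁ b₁ a₂ g₂ b₂ n₁ n₂)
    (hc : (Γ.induce (wordSupp g₁)).Connected) (hp₁ : IsPrimitive (eval Γ g₁))
    (hp₂ : IsPrimitive (eval Γ g₂)) :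
    eval Γ (a₁ * g₁ ^ (n₁ + 1) * b₁) = eval Γ (a₂ * g₂ ^ (n₂ + 1) * b₂) := by
  obtain ⟨s, t, hs, ht, hst, hcount⟩ := h.exists_coprime hc
  obtain rfl : s = 1 := h.eq_one_of_isPrimitive hp₁ hs hst hcount
  obtain rfl : t = 1 := h.symm.eq_one_of_isPrimitive hp₂ ht hst.symm fun v => (hcount v).symm
  refine eval_eq_of_proj_eq (funext fun K => ?_)
  simp only [map_mul, map_pow, Pi.mul_apply, Pi.pow_apply]
  refine (h K).pow_succ_eq ?_
  simpa only [length_proj, mul_one] using Finset.sum_congr rfl fun v _ => hcount v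

end CliqueOverlap

end CliqueOverlap

theorem isConj_and_conj_eq_of_pow_succ_eq {G : Type*} [Group G] {a₁ g₁ b₁ a₂ g₂ b₂ : G}
    {n₁ n₂ : ℕ} (h : a₁ * g₁ ^ n₁ * b₁ = a₂ * g₂ ^ n₂ * b₂)
    (h' : a₁ * g₁ ^ (n₁ + 1) * b₁ = a₂ * g₂ ^ (n₂ + 1) * b₂) :
    IsConj g₁ g₂ ∧ a₁ * g₁ * a₁⁻¹ = a₂ * g₂ * a₂⁻¹ ∧ b₁⁻¹ * g₁ * b₁ = b₂⁻¹ * g₂ * b₂ := by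
  have hconj : a₁ * g₁ * a₁⁻¹ = a₂ * g₂ * a₂⁻¹ := by
    calc a₁ * g₁ * a₁⁻¹ = a₁ * g₁ ^ (n₁ + 1) * b₁ * (a₁ * g₁ ^ n₁ * b₁)⁻¹ := by group
      _ = a₂ * g₂ ^ (n₂ + 1) * b₂ * (a₂ * g₂ ^ n₂ * b₂)⁻¹ := by rw [h, h']
      _ = a₂ * g₂ * a₂⁻¹ := by group
  refine ⟨(isConj_iff.2 ⟨a₁, hconj⟩).trans (isConj_iff.2 ⟨a₂, rfl⟩).symm, hconj, ?_⟩
  calc b₁⁻¹ * g₁ * b₁ = (a₁ * g₁ ^ n₁ * b₁)⁻¹ * (a₁ * g₁ ^ (n₁ + 1) * b₁) := by group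
    _ = (a₂ * g₂ ^ n₂ * b₂)⁻¹ * (a₂ * g₂ ^ (n₂ + 1) * b₂) := by rw [h, h']
    _ = b₂⁻¹ * g₂ * b₂ := by group

theorem IsGeodesicPowerDecomposition.mul_pow_succ_mul_eq {V : Type*} [Fintype V] {Γ : SimpleGraph V}
    {h a₁ g₁ b₁ a₂ g₂ b₂ : Grp Γ} {n₁ n₂ : ℕ}
    (hdec₁ : IsGeodesicPowerDecomposition h a₁ g₁ n₁ b₁)
    (hdec₂ : IsGeodesicPowerDecomposition h a₂ g₂ n₂ b₂)
    (hs₁ : StronglyNonSplit g₁) (hs₂ : StronglyNonSplit g₂)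
    (hp₁ : IsPrimitive g₁) (hp₂ : IsPrimitive g₂)
    (hl₁ : max (wordLength a₁) (wordLength a₂) + max (wordLength b₁) (wordLength b₂) +
      2 * Fintype.card V * wordLength g₁ ≤ wordLength h)
    (hl₂ : max (wordLength a₁) (wordLength a₂) + max (wordLength b₁) (wordLength b₂) +
      2 * Fintype.card V * wordLength g₂ ≤ wordLength h) :
    a₁ * g₁ ^ (n₁ + 1) * b₁ = a₂ * g₂ ^ (n₂ + 1) * b₂ := by
  classical
  obtain ⟨a₁, hra₁, rfl⟩ := exists_isReducedWord a₁
  obtain ⟨a₂, hra₂, rfl⟩ := exists_isReducedWord a₂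
  obtain ⟨b₁, hrb₁, rfl⟩ := exists_isReducedWord b₁
  obtain ⟨b₂, hrb₂, rfl⟩ := exists_isReducedWord b₂
  obtain ⟨g₁, hrg₁, rfl⟩ := exists_isReducedWord g₁
  obtain ⟨g₂, hrg₂, rfl⟩ := exists_isReducedWord g₂
  have hS₁ := hrg₁.supp_eval ▸ hs₁.isConnectedDominating_supp
  have hS₂ := hrg₂.supp_eval ▸ hs₂.isConnectedDominating_supp
  have hred₁ := hdec₁.isReducedWord hra₁ hrg₁ hrb₁
  have hred₂ := hdec₂.isReducedWord hra₂ hrg₂ hrb₂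
  have heval₁ : eval Γ (a₁ * g₁ ^ n₁ * b₁) = h := by simp only [hdec₁.eq, map_mul, map_pow]
  have heval₂ : eval Γ (a₂ * g₂ ^ n₂ * b₂) = h := by simp only [hdec₂.eq, map_mul, map_pow]
  have hproj := hred₁.proj_eq hred₂ (heval₁.trans heval₂.symm)
  rw [isReducedWord_iff] at *
  rw [heval₁] at hred₁
  rw [heval₂] at hred₂
  rw [← hra₁, ← hra₂, ← hrb₁, ← hrb₂, ← hrg₁, ← hred₁] at hl₁
  rw [← hra₁, ← hra₂, ← hrb₁, ← hrb₂, ← hrg₂, ← hred₂] at hl₂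
  have hover : CliqueOverlap Γ a₁ g₁ b₁ a₂ g₂ b₂ n₁ n₂ := .of_length_le hS₁ hS₂ hproj hl₁ hl₂
  simpa only [map_mul, map_pow] using hover.eval_pow_succ_eq hS₁.connected hp₁ hp₂

end RAAG

theorem mainTheorem3_general {V : Type*} [Fintype V] (Γ : SimpleGraph V)
    (h a₁ a₂ b₁ b₂ g₁ g₂ : RAAG.Grp Γ) (n₁ n₂ : ℕ)
    (hdec₁ : RAAG.IsGeodesicPowerDecomposition h a₁ g₁ n₁ b₁)
    (hdec₂ : RAAG.IsGeodesicPowerDecomposition h a₂ g₂ n₂ b₂)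
    (hs₁ : RAAG.StronglyNonSplit g₁) (hs₂ : RAAG.StronglyNonSplit g₂)
    (hp₁ : RAAG.IsPrimitive g₁) (hp₂ : RAAG.IsPrimitive g₂)
    (A B : ℝ)
    (ha₁ : (RAAG.wordLength a₁ : ℝ) ≤ A) (ha₂ : (RAAG.wordLength a₂ : ℝ) ≤ A)
    (hb₁ : (RAAG.wordLength b₁ : ℝ) ≤ B) (hb₂ : (RAAG.wordLength b₂ : ℝ) ≤ B)
    (hh₁ : 2 * (Fintype.card V : ℝ) * (RAAG.wordLength g₁ : ℝ) ≤
      (RAAG.wordLength h : ℝ) - (A + B))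
    (hh₂ : 2 * (Fintype.card V : ℝ) * (RAAG.wordLength g₂ : ℝ) ≤
      (RAAG.wordLength h : ℝ) - (A + B)) :
    IsConj g₁ g₂ ∧
      a₁ * g₁ * a₁⁻¹ = a₂ * g₂ * a₂⁻¹ ∧
      b₁⁻¹ * g₁ * b₁ = b₂⁻¹ * g₂ * b₂ := by
  have hmax : max (RAAG.wordLength a₁ : ℝ) (RAAG.wordLength a₂) +
      max (RAAG.wordLength b₁ : ℝ) (RAAG.wordLength b₂) ≤ A + B :=
    add_le_add (max_le ha₁ ha₂) (max_le hb₁ hb₂)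
  have hl {g : RAAG.Grp Γ} (hg : 2 * (Fintype.card V : ℝ) * (RAAG.wordLength g : ℝ) ≤
      (RAAG.wordLength h : ℝ) - (A + B)) :
      max (RAAG.wordLength a₁) (RAAG.wordLength a₂) +
        max (RAAG.wordLength b₁) (RAAG.wordLength b₂) +
        2 * Fintype.card V * RAAG.wordLength g ≤ RAAG.wordLength h := by
    rify
    linarith
  exact RAAG.isConj_and_conj_eq_of_pow_succ_eq (hdec₁.eq.symm.trans hdec₂.eq)
    (hdec₁.mul_pow_succ_mul_eq hdec₂ hs₁ hs₂ hp₁ hp₂ (hl hh₁) (hl hh₂))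

theorem mainTheorem3 {V : Type*} [Fintype V] (Γ : SimpleGraph V) (hΓ : Γ.Connected)
    (h a₁ a₂ b₁ b₂ g₁ g₂ : RAAG.Grp Γ) (n₁ n₂ : ℕ) (hn₁ : 1 ≤ n₁) (hn₂ : 1 ≤ n₂)
    (hdec₁ : RAAG.IsGeodesicPowerDecomposition h a₁ g₁ n₁ b₁)
    (hdec₂ : RAAG.IsGeodesicPowerDecomposition h a₂ g₂ n₂ b₂)
    (hs₁ : RAAG.StronglyNonSplit g₁) (hs₂ : RAAG.StronglyNonSplit g₂)
    (hp₁ : RAAG.IsPrimitive g₁) (hp₂ : RAAG.IsPrimitive g₂)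
    (A B : ℝ) (hA : 0 ≤ A) (hB : 0 ≤ B)
    (ha₁ : (RAAG.wordLength a₁ : ℝ) ≤ A) (ha₂ : (RAAG.wordLength a₂ : ℝ) ≤ A)
    (hb₁ : (RAAG.wordLength b₁ : ℝ) ≤ B) (hb₂ : (RAAG.wordLength b₂ : ℝ) ≤ B)
    (hh₁ : (2 * (Fintype.card V : ℝ) + 1) * (RAAG.wordLength g₁ : ℝ) ≤
      (RAAG.wordLength h : ℝ) - (A + B))
    (hh₂ : (2 * (Fintype.card V : ℝ) + 1) * (RAAG.wordLength g₂ : ℝ) ≤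
      (RAAG.wordLength h : ℝ) - (A + B)) :
    IsConj g₁ g₂ ∧
      a₁ * g₁ * a₁⁻¹ = a₂ * g₂ * a₂⁻¹ ∧
      b₁⁻¹ * g₁ * b₁ = b₂⁻¹ * g₂ * b₂ := by
  exact mainTheorem3_general Γ h a₁ a₂ b₁ b₂ g₁ g₂ n₁ n₂ hdec₁ hdec₂ hs₁ hs₂ hp₁ hp₂ A B
    ha₁ ha₂ hb₁ hb₂ (by linarith) (by linarith)
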